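/- Let $\mathcal L_A$ be the first-order language (with equality) of signature $\langle 0,1,+,\times,<\rangle$, let $\mathbb N$ be the standard $\mathcal L_A$-structure on the natural numbers, and let $P$ be a new unary relation symbol. The class of $\Delta_0$ formulae of $\mathcal L_A\cup\{P\}$ is the smallest class that contains the quantifier-free formulae and is closed under propositional connectives and bounded quantifiers $\forall x<t$, $\exists x<t$ ($t$ a term not containing $x$); the $\Pi_1$ formulae are those obtained from $\Delta_0$ formulae by prefixing finitely many (possibly zero) universal quantifiers, and the $\Sigma_2$ formulae are those obtained from $\Pi_1$ formulae by prefixing finitely many (possibly zero) existential quantifiers. Let $\alpha$ be a $\Sigma_2$-sentence of $\mathcal L_A\cup\{P\}$ that has a standard model, i.e. $\mathbb N$ can be expanded to an $\mathcal L_A\cup\{P\}$-structure in which $\alpha$ is true. Then there is an arithmetically definable set $A\subseteq\mathbb N$ (i.e. a set defined in $\mathbb N$ by an $\mathcal L_A$-formula with one free variable) such that $(\mathbb N,A)\models\alpha$, where $(\mathbb N,A)$ is the expansion of $\mathbb N$ in which $P$ is interpreted by $A$. -/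

import Mathlib

namespace TruthArith

open FirstOrder FirstOrder.Language

/-- The function symbols of the language of arithmetic: the constants `0`, `1` and the binary
operations `+`, `×`. -/
inductive ArithFunc : ℕ → Type
  | zero : ArithFunc 0
  | one : ArithFunc 0
  | add : ArithFunc 2
  | mul : ArithFunc 2

/-- The only relation symbol of the language of arithmetic: the binary symbol `<`. -/
inductive ArithRel : ℕ → Type
  | lt : ArithRel 2

/-- The language of arithmetic, of signature `⟨0, 1, +, ×, <⟩` (equality is logical). -/
def LA : FirstOrder.Language.{0, 0} := ⟨ArithFunc, ArithRel⟩

/-- The standard model of arithmetic. -/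
instance standardModel : LA.Structure ℕ where
  funMap {_} f v :=
    match f with
    | ArithFunc.zero => 0
    | ArithFunc.one => 1
    | ArithFunc.add => v 0 + v 1
    | ArithFunc.mul => v 0 * v 1
  RelMap {_} r v :=
    match r with
    | ArithRel.lt => v 0 < v 1

/-- A single unary relation symbol `P`. -/
inductive PredRel : ℕ → Type
  | P : PredRel 1

/-- The language whose only symbol is the unary relation symbol `P`. -/
def LP : FirstOrder.Language.{0, 0} := ⟨fun _ => Empty, PredRel⟩

/-- The language of arithmetic together with the unary relation symbol `P`. -/
abbrev LAP : FirstOrder.Language.{0, 0} := LA.sum LP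

/-- The inclusion of the language of arithmetic in its extension by `P`. -/
abbrev arithIncl : LA →ᴸ LAP := LHom.sumInl

/-- The interpretation of `P` in `ℕ` by the set `A`. -/
@[reducible] def predStructure (A : Set ℕ) : LP.Structure ℕ where
  funMap {_} f _ := nomatch f
  RelMap {_} r v :=
    match r with
    | PredRel.P => v 0 ∈ A

/-- The structure `(ℕ, A)`: the standard model of arithmetic with `P` interpreted by `A`. -/
@[reducible] def expandBy (A : Set ℕ) : LAP.Structure ℕ :=
  letI := predStructure A
  inferInstance

/-- `(ℕ, A) ⊨ α`. -/
def ModelsWith (A : Set ℕ) (α : LAP.Sentence) : Prop :=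
  letI := expandBy A
  ℕ ⊨ α

/-- A sentence of a language `L` extending the language of arithmetic has a standard model if the
standard model of arithmetic can be expanded to an `L`-structure in which the sentence is true. -/
def HasStandardModel {L : FirstOrder.Language.{0, 0}} (ι : LA →ᴸ L) (α : L.Sentence) : Prop :=
  ∃ _ : L.Structure ℕ, ι.IsExpansionOn ℕ ∧ ℕ ⊨ α

/-- A set of natural numbers is arithmetically definable if it is defined in the standard model by
a formula of the language of arithmetic (without parameters). -/
def ArithDefinable (A : Set ℕ) : Prop :=
  (∅ : Set ℕ).Definable₁ LA A

section Hierarchy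

variable {L : FirstOrder.Language.{0, 0}} (ι : LA →ᴸ L) {β : Type}

/-- The formula `x < t`, where `x` is the variable `n` and `t` is a term in which `x` does not
occur. -/
def varLt {n : ℕ} (t : L.Term (β ⊕ Fin n)) : L.BoundedFormula β (n + 1) :=
  (ι.onRelation ArithRel.lt : L.Relations 2).boundedFormula₂
    (Term.var (Sum.inr (Fin.last n)))
    (t.relabel (Sum.map id Fin.castSucc))

/-- The bounded quantification `∀ x < t. φ`, that is `∀ x (x < t → φ)`. -/
def ballLt {n : ℕ} (t : L.Term (β ⊕ Fin n)) (φ : L.BoundedFormula β (n + 1)) :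
    L.BoundedFormula β n :=
  ((varLt ι t).imp φ).all

/-- The bounded quantification `∃ x < t. φ`, that is `∃ x (x < t ∧ φ)`. -/
def bexLt {n : ℕ} (t : L.Term (β ⊕ Fin n)) (φ : L.BoundedFormula β (n + 1)) :
    L.BoundedFormula β n :=
  (varLt ι t ⊓ φ).ex

/-- The `Δ₀` formulae of `L`: the closure of the quantifier-free formulae under propositional
connectives (all of them are built from `⊥` and `→`) and bounded quantifiers. -/
inductive IsDeltaZero : ∀ {n : ℕ}, L.BoundedFormula β n → Prop
  | of_isQF {n : ℕ} {φ : L.BoundedFormula β n} (h : φ.IsQF) : IsDeltaZero φ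
  | imp {n : ℕ} {φ ψ : L.BoundedFormula β n} (hφ : IsDeltaZero φ) (hψ : IsDeltaZero ψ) :
      IsDeltaZero (φ.imp ψ)
  | ball {n : ℕ} (t : L.Term (β ⊕ Fin n)) {φ : L.BoundedFormula β (n + 1)}
      (h : IsDeltaZero φ) : IsDeltaZero (ballLt ι t φ)
  | bex {n : ℕ} (t : L.Term (β ⊕ Fin n)) {φ : L.BoundedFormula β (n + 1)}
      (h : IsDeltaZero φ) : IsDeltaZero (bexLt ι t φ)

/-- The `Π₁` formulae of `L`: the closure of the `Δ₀` (that is, `Σ₀`) formulae under universal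
quantification. -/
inductive IsPiOne : ∀ {n : ℕ}, L.BoundedFormula β n → Prop
  | of_isDeltaZero {n : ℕ} {φ : L.BoundedFormula β n} (h : IsDeltaZero ι φ) : IsPiOne φ
  | all {n : ℕ} {φ : L.BoundedFormula β (n + 1)} (h : IsPiOne φ) : IsPiOne φ.all

/-- The `Σ₂` formulae of `L`: the closure of the `Π₁` formulae under existential
quantification. -/
inductive IsSigmaTwo : ∀ {n : ℕ}, L.BoundedFormula β n → Prop
  | of_isPiOne {n : ℕ} {φ : L.BoundedFormula β n} (h : IsPiOne ι φ) : IsSigmaTwo φ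
  | ex {n : ℕ} {φ : L.BoundedFormula β (n + 1)} (h : IsSigmaTwo φ) : IsSigmaTwo φ.ex

end Hierarchy

end TruthArith

namespace TruthArith

open FirstOrder FirstOrder.Language

/-! Fix numbers witnessing the outer existential quantifiers. A `Π₁` condition on `P` then defines a
closed class in Cantor space: a `Δ₀` condition inspects only finitely many values of `P`, so it is
clopen, and cutting the universal quantifiers off at `m` gives a decreasing sequence of clopen
classes `R m` whose intersection is the given class (`IsPiOne.exists_clopen_approximation`).

A nonempty closed class contains its leftmost branch (`leftmost_mem`), and this branch is
arithmetical. Whether a prefix can be extended by `0` is a question about infinite sets, but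
compactness turns it into "for every `m`, some coded set with this longer prefix lies in `R m`"
(`hasLeft_iInter_iff`), which quantifies over numbers only. The course-of-values recursion defining
the branch is unwound by coding prefixes with Gödel's divisibility trick (`exists_decodeSet_eq`,
`arithDefinable_leftmost`). -/

/-! ### Closure properties of arithmetical predicates -/

/-- A function of number variables is a term function if it is
the value of a term of the language of arithmetic. -/
def IsTermFun {β : Type} (f : (β → ℕ) → ℕ) : Prop :=
  ∃ t : LA.Term β, ∀ v, t.realize v = f v

/-- A predicate is arithmetical if it is the truth set of a formula of the language of
arithmetic. -/
def IsArith {β : Type} (p : (β → ℕ) → Prop) : Prop :=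
  ∃ φ : LA.Formula β, ∀ v, φ.Realize v ↔ p v

namespace IsTermFun

variable {β : Type} {f g : (β → ℕ) → ℕ}

theorem var (b : β) : IsTermFun (fun v => v b) :=
  ⟨Term.var b, fun _ => rfl⟩

theorem add (hf : IsTermFun f) (hg : IsTermFun g) : IsTermFun (fun v => f v + g v) := by
  obtain ⟨s, hs⟩ := hf
  obtain ⟨t, ht⟩ := hg
  exact ⟨Functions.apply₂ (L := LA) ArithFunc.add s t, fun v =>
    Term.realize_functions_apply₂.trans (congrArg₂ (· + ·) (hs v) (ht v))⟩

theorem mul (hf : IsTermFun f) (hg : IsTermFun g) : IsTermFun (fun v => f v * g v) := by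
  obtain ⟨s, hs⟩ := hf
  obtain ⟨t, ht⟩ := hg
  exact ⟨Functions.apply₂ (L := LA) ArithFunc.mul s t, fun v =>
    Term.realize_functions_apply₂.trans (congrArg₂ (· * ·) (hs v) (ht v))⟩

theorem zero : IsTermFun (fun _ : β → ℕ => 0) :=
  ⟨Term.func (L := LA) ArithFunc.zero ![], fun _ => rfl⟩

theorem one : IsTermFun (fun _ : β → ℕ => 1) :=
  ⟨Term.func (L := LA) ArithFunc.one ![], fun _ => rfl⟩

theorem const (k : ℕ) : IsTermFun (fun _ : β → ℕ => k) := by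
  induction k with
  | zero => exact zero
  | succ k ih => exact ih.add one

theorem comp {γ : Type} (hf : IsTermFun f) (r : β → γ) : IsTermFun (fun w : γ → ℕ => f (w ∘ r)) := by
  obtain ⟨t, ht⟩ := hf
  exact ⟨t.relabel r, fun w => by rw [Term.realize_relabel, ht]⟩

theorem lift (hf : IsTermFun f) :
    IsTermFun (fun w : Option β → ℕ => f (fun b => w (some b))) :=
  hf.comp some

end IsTermFun

namespace IsArith

variable {β : Type} {f g : (β → ℕ) → ℕ} {p q : (β → ℕ) → Prop}

theorem congr (h : IsArith p) (hpq : ∀ v, p v ↔ q v) : IsArith q := by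
  obtain ⟨φ, hφ⟩ := h
  exact ⟨φ, fun v => (hφ v).trans (hpq v)⟩

theorem eq (hf : IsTermFun f) (hg : IsTermFun g) : IsArith (fun v => f v = g v) := by
  obtain ⟨s, hs⟩ := hf
  obtain ⟨t, ht⟩ := hg
  exact ⟨s.equal t, fun v => by rw [Formula.realize_equal, hs, ht]⟩

theorem lt (hf : IsTermFun f) (hg : IsTermFun g) : IsArith (fun v => f v < g v) := by
  obtain ⟨s, hs⟩ := hf
  obtain ⟨t, ht⟩ := hg
  exact ⟨Relations.formula₂ (L := LA) ArithRel.lt s t, fun v =>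
    Formula.realize_rel₂.trans (iff_of_eq (congrArg₂ (· < ·) (hs v) (ht v)))⟩

theorem false : IsArith (fun _ : β → ℕ => False) :=
  ⟨⊥, fun _ => Iff.rfl⟩

theorem imp (hp : IsArith p) (hq : IsArith q) : IsArith (fun v => p v → q v) := by
  obtain ⟨φ, hφ⟩ := hp
  obtain ⟨ψ, hψ⟩ := hq
  exact ⟨φ.imp ψ, fun v => by rw [Formula.realize_imp, hφ, hψ]⟩

theorem not (hp : IsArith p) : IsArith (fun v => ¬ p v) :=
  hp.imp false

theorem and (hp : IsArith p) (hq : IsArith q) : IsArith (fun v => p v ∧ q v) :=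
  (hp.imp hq.not).not.congr fun v => by tauto

theorem iff (hp : IsArith p) (hq : IsArith q) : IsArith (fun v => p v ↔ q v) :=
  ((hp.imp hq).and (hq.imp hp)).congr fun v => by tauto

theorem all {p : (β → ℕ) → ℕ → Prop}
    (h : IsArith (fun w : Option β → ℕ => p (fun b => w (some b)) (w none))) :
    IsArith (fun v => ∀ x, p v x) := by
  obtain ⟨φ, hφ⟩ := h
  refine ⟨Formula.iAlls Unit
    (Formula.relabel (fun o : Option β => o.elim (Sum.inr ()) Sum.inl) φ), fun v => ?_⟩
  simp only [Formula.realize_iAlls, Formula.realize_relabel, hφ]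
  exact ⟨fun H x => H fun _ => x, fun H i => H (i ())⟩

theorem ex {p : (β → ℕ) → ℕ → Prop}
    (h : IsArith (fun w : Option β → ℕ => p (fun b => w (some b)) (w none))) :
    IsArith (fun v => ∃ x, p v x) :=
  (all (p := fun v x => ¬ p v x) h.not).not.congr fun v => by push Not; rfl

theorem dvd (hf : IsTermFun f) (hg : IsTermFun g) : IsArith (fun v => f v ∣ g v) :=
  ex (p := fun v k => g v = f v * k) (eq hg.lift (hf.lift.mul (.var none)))

end IsArith

/-! ### Coding finite sets by divisibility -/

/-- The characteristic function of the finite set coded by the pair `(c, d)`. -/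
def decodeSet (c d : ℕ) (i : ℕ) : Bool :=
  decide (1 + (i + 1) * d ∣ c)

theorem IsArith.decodeSet {β : Type} {c d i : (β → ℕ) → ℕ} (hc : IsTermFun c) (hd : IsTermFun d)
    (hi : IsTermFun i) : IsArith (fun v => decodeSet (c v) (d v) (i v) = true) :=
  (IsArith.dvd (IsTermFun.one.add ((hi.add .one).mul hd)) hc).congr fun v => by
    simp [TruthArith.decodeSet]

/-- A common prime divisor divides the difference `(j - i) * N!`, hence `N!` because `j - i ≤ N`,
and therefore divides `1`. -/
theorem coprime_one_add_mul_factorial {N i j : ℕ} (hij : i < j) (hj : j < N) :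
    Nat.Coprime (1 + (i + 1) * N.factorial) (1 + (j + 1) * N.factorial) := by
  refine Nat.coprime_of_dvd fun p hp hi hj' => ?_
  have hd : p ∣ (j - i) * N.factorial := by
    have h := Nat.dvd_sub hj' hi
    have e : 1 + (j + 1) * N.factorial - (1 + (i + 1) * N.factorial) = (j - i) * N.factorial := by
      rw [Nat.add_sub_add_left, ← Nat.sub_mul, Nat.add_sub_add_right]
    rwa [e] at h
  have hN : p ∣ N.factorial := by
    rcases hp.dvd_mul.1 hd with h | h
    · exact h.trans (Nat.dvd_factorial (by omega) (by omega))
    · exact h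
  exact hp.one_lt.ne' (Nat.dvd_one.1 ((Nat.dvd_add_left (hN.mul_left _)).1 hi))

/-- Take for `c` the product of the moduli of the elements. The modulus of a non-element is coprime
to `c` and exceeds `1`, so it cannot divide `c`. -/
theorem exists_decodeSet_eq (f : ℕ → Bool) (N : ℕ) :
    ∃ c d, ∀ i < N, decodeSet c d i = f i := by
  refine ⟨∏ j ∈ (Finset.range N).filter (fun j => f j = true), (1 + (j + 1) * N.factorial),
    N.factorial, fun i hi => ?_⟩
  rw [Bool.eq_iff_iff, decodeSet, decide_eq_true_iff]
  constructor
  · intro h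
    by_contra hf
    have hcop := Nat.Coprime.prod_right (x := 1 + (i + 1) * N.factorial)
      (t := (Finset.range N).filter (fun j => f j = true))
      (s := fun j => 1 + (j + 1) * N.factorial) (fun j hj => by
        simp only [Finset.mem_filter, Finset.mem_range] at hj
        rcases lt_trichotomy i j with hlt | rfl | hlt
        · exact coprime_one_add_mul_factorial hlt hj.1
        · exact absurd hj.2 hf
        · exact (coprime_one_add_mul_factorial hlt hi).symm)
    have h1 := Nat.Coprime.eq_one_of_dvd hcop h
    have : 0 < (i + 1) * N.factorial := by positivity
    omega
  · intro h
    exact Finset.dvd_prod_of_mem (fun j => 1 + (j + 1) * N.factorial) (by simp [hi, h])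

/-! ### The leftmost branch of a closed class -/

theorem exists_cylinder_subset {U : Set (ℕ → Bool)} (hU : IsOpen U) {f : ℕ → Bool} (hf : f ∈ U) :
    ∃ n, ∀ g : ℕ → Bool, (∀ j < n, g j = f j) → g ∈ U := by
  obtain ⟨_, ⟨x, n, rfl⟩, hx, hsub⟩ :=
    (PiNat.isTopologicalBasis_cylinders (fun _ : ℕ => Bool)).exists_subset_of_mem_open hf hU
  refine ⟨n, fun g hg => hsub ?_⟩
  rw [PiNat.mem_cylinder_iff] at hx ⊢
  exact fun i hi => (hg i hi).trans (hx i hi)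

theorem isClopen_setOf_apply_eq (i : ℕ) (b : Bool) : IsClopen {f : ℕ → Bool | f i = b} :=
  (isClopen_discrete {b}).preimage (continuous_apply i)

/-- The class `C` has an element that agrees with `f` below `i` and does not contain `i`. -/
def HasLeft (C : Set (ℕ → Bool)) (f : ℕ → Bool) (i : ℕ) : Prop :=
  ∃ g ∈ C, (∀ j < i, g j = f j) ∧ g i = false

theorem HasLeft.congr {C : Set (ℕ → Bool)} {f f' : ℕ → Bool} {i : ℕ} (h : ∀ j < i, f j = f' j) :
    HasLeft C f i ↔ HasLeft C f' i := by
  unfold HasLeft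
  refine exists_congr fun g => and_congr_right fun _ => and_congr_left fun _ => ?_
  exact forall₂_congr fun j hj => by rw [h j hj]

open Classical in
/-- The first `n` values of the leftmost branch of the class `C`. -/
noncomputable def leftmostAux (C : Set (ℕ → Bool)) : ℕ → ℕ → Bool
  | 0 => fun _ => false
  | n + 1 => Function.update (leftmostAux C n) n (!decide (HasLeft C (leftmostAux C n) n))

/-- The leftmost branch of the class `C`. -/
noncomputable def leftmost (C : Set (ℕ → Bool)) (n : ℕ) : Bool :=
  leftmostAux C (n + 1) n

theorem leftmostAux_eq (C : Set (ℕ → Bool)) {n j : ℕ} (h : j < n) :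
    leftmostAux C n j = leftmost C j := by
  induction n with
  | zero => omega
  | succ n ih =>
    rcases Nat.lt_succ_iff_lt_or_eq.1 h with h | rfl
    · rw [leftmostAux, Function.update_of_ne h.ne, ih h]
    · rfl

/-- The recursion in self-referential form: `HasLeft` at `n` looks only at values below `n`, so the
finite stage may be replaced by the whole branch. By `eq_leftmost_of_forall` this equivalence
determines every prefix. -/
theorem leftmost_eq_true_iff (C : Set (ℕ → Bool)) (n : ℕ) :
    leftmost C n = true ↔ ¬ HasLeft C (leftmost C) n := by
  rw [← HasLeft.congr (fun j hj => leftmostAux_eq C hj), leftmost, leftmostAux,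
    Function.update_self]
  simp

theorem eq_leftmost_of_forall {C : Set (ℕ → Bool)} {f : ℕ → Bool} {n : ℕ}
    (h : ∀ i < n, f i = true ↔ ¬ HasLeft C f i) : ∀ i < n, f i = leftmost C i := by
  intro i
  induction i using Nat.strong_induction_on with
  | _ i ih =>
    intro hi
    rw [Bool.eq_iff_iff, h i hi, leftmost_eq_true_iff,
      HasLeft.congr (fun j hj => ih j hj (hj.trans hi))]

/-- Every prefix of the branch extends to an element of `C`; a closed class contains any limit of
such prefixes. -/
theorem leftmost_mem {C : Set (ℕ → Bool)} (hC : IsClosed C) (hne : C.Nonempty) :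
    leftmost C ∈ C := by
  have key : ∀ n, ∃ g ∈ C, ∀ j < n, g j = leftmost C j := by
    intro n
    induction n with
    | zero => exact ⟨_, hne.some_mem, fun j hj => absurd hj j.not_lt_zero⟩
    | succ n ih =>
      by_cases hl : HasLeft C (leftmost C) n
      · have hf : leftmost C n = false := by
          rw [← Bool.not_eq_true, leftmost_eq_true_iff]
          exact not_not.2 hl
        obtain ⟨g, hg, hag, hgn⟩ := hl
        refine ⟨g, hg, fun j hj => ?_⟩
        rcases Nat.lt_succ_iff_lt_or_eq.1 hj with hj | rfl
        · exact hag j hj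
        · rw [hgn, hf]
      -- No extension takes the value `false` at `n`, so the element given by induction must already
      -- be `true` there.
      · obtain ⟨g, hg, hag⟩ := ih
        refine ⟨g, hg, fun j hj => ?_⟩
        rcases Nat.lt_succ_iff_lt_or_eq.1 hj with hj | rfl
        · exact hag j hj
        · rw [(leftmost_eq_true_iff C j).2 hl, ← Bool.not_eq_false]
          exact fun h => hl ⟨g, hg, hag, h⟩
  by_contra hmem
  obtain ⟨n, hn⟩ := exists_cylinder_subset hC.isOpen_compl hmem
  obtain ⟨g, hg, hag⟩ := key n
  exact hn g hag hg

/-- Forwards, openness of `R m` allows the witness to be replaced by a coded set sharing a long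
enough prefix. Backwards, the coded sets show that a decreasing sequence of closed sets in a compact
space has nonempty members, so its intersection is nonempty. -/
theorem hasLeft_iInter_iff {R : ℕ → Set (ℕ → Bool)} (hR : ∀ m, IsClopen (R m)) (hanti : Antitone R)
    (f : ℕ → Bool) (i : ℕ) :
    HasLeft (⋂ m, R m) f i ↔ ∀ m, ∃ c d, decodeSet c d ∈ R m ∧
      (∀ j < i, decodeSet c d j = true ↔ f j = true) ∧ ¬ decodeSet c d i = true := by
  have hcl : IsClopen {g : ℕ → Bool | (∀ j < i, g j = f j) ∧ g i = false} := by
    refine IsClopen.inter ?_ (isClopen_setOf_apply_eq i false)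
    have := (Set.finite_lt_nat i).isClopen_biInter
      (f := fun j => {g : ℕ → Bool | g j = f j}) fun j _ => isClopen_setOf_apply_eq j (f j)
    have e : {g : ℕ → Bool | ∀ j < i, g j = f j} = ⋂ j ∈ {j | j < i}, {g | g j = f j} := by
      ext g
      simp
    rw [← e] at this
    exact this
  constructor
  · rintro ⟨g, hg, hgi⟩ m
    obtain ⟨n, hn⟩ := exists_cylinder_subset ((hR m).inter hcl).isOpen ⟨Set.mem_iInter.1 hg m, hgi⟩
    obtain ⟨c, d, hcd⟩ := exists_decodeSet_eq g n
    obtain ⟨h1, h2, h3⟩ := hn _ hcd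
    exact ⟨c, d, h1, fun j hj => by rw [h2 j hj], by rw [h3]; simp⟩
  · intro h
    have hne := IsCompact.nonempty_iInter_of_sequence_nonempty_isCompact_isClosed
      (fun m => R m ∩ {g : ℕ → Bool | (∀ j < i, g j = f j) ∧ g i = false})
      (fun m => Set.inter_subset_inter_left _ (hanti m.le_succ))
      (fun m => by
        obtain ⟨c, d, h1, h2, h3⟩ := h m
        exact ⟨_, h1, fun j hj => Bool.eq_iff_iff.2 (h2 j hj), by simpa using h3⟩)
      ((hR 0).inter hcl).isClosed.isCompact (fun m => ((hR m).inter hcl).isClosed)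
    obtain ⟨g, hg⟩ := hne
    rw [Set.mem_iInter] at hg
    exact ⟨g, Set.mem_iInter.2 fun m => (hg m).1, (hg 0).2⟩

/-! ### Arithmetical definability of the leftmost branch -/

/-- A sequence of sets is uniformly arithmetical on the codes of finite sets. -/
def ArithOnCodes (R : ℕ → Set (ℕ → Bool)) : Prop :=
  ∀ {β : Type} {m c d : (β → ℕ) → ℕ}, IsTermFun m → IsTermFun c → IsTermFun d →
    IsArith (fun v => decodeSet (c v) (d v) ∈ R (m v))

theorem arithDefinable_leftmost {R : ℕ → Set (ℕ → Bool)} (hR : ∀ m, IsClopen (R m))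
    (hanti : Antitone R) (hdef : ArithOnCodes R) :
    ArithDefinable {n | leftmost (⋂ m, R m) n = true} := by
  have hleft : ∀ {β : Type} {c d i : (β → ℕ) → ℕ}, IsTermFun c → IsTermFun d → IsTermFun i →
      IsArith (fun v => HasLeft (⋂ m, R m) (decodeSet (c v) (d v)) (i v)) := by
    intro β c d i hc hd hi
    simp only [hasLeft_iInter_iff hR hanti]
    refine .all (.ex (.ex ((hdef (.var _) (.var _) (.var _)).and (.and (.all ?_) ?_))))
    · exact (IsArith.lt (.var _) hi.lift.lift.lift.lift).imp
        (.iff (.decodeSet (.var _) (.var _) (.var _))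
          (.decodeSet hc.lift.lift.lift.lift hd.lift.lift.lift.lift (.var _)))
    · exact (IsArith.decodeSet (.var _) (.var _) hi.lift.lift.lift).not
  -- `n` lies on the branch iff some coded set obeys the recursion up to and including `n` and
  -- contains `n`. The bound `v 0 + 1` makes the recursion cover the queried value itself.
  have hmain : IsArith (fun v : Fin 1 → ℕ => ∃ c d, (∀ i, i < v 0 + 1 →
      (decodeSet c d i = true ↔ ¬ HasLeft (⋂ m, R m) (decodeSet c d) i)) ∧
        decodeSet c d (v 0) = true) := by
    refine .ex (.ex (.and (.all ?_) (.decodeSet (.var _) (.var _) (.var _))))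
    exact (IsArith.lt (.var _) (.add (.var _) .one)).imp
      (.iff (.decodeSet (.var _) (.var _) (.var _)) (hleft (.var _) (.var _) (.var _)).not)
  obtain ⟨φ, hφ⟩ := hmain
  rw [ArithDefinable, Set.Definable₁, Set.empty_definable_iff]
  refine ⟨φ, Set.ext fun v => ?_⟩
  refine Iff.trans ?_ (hφ v).symm
  constructor
  · intro hv
    obtain ⟨c, d, hcd⟩ := exists_decodeSet_eq (leftmost (⋂ m, R m)) (v 0 + 1)
    refine ⟨c, d, fun i hi => ?_, (hcd _ (Nat.lt_succ_self _)).trans hv⟩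
    rw [hcd i hi, leftmost_eq_true_iff,
      HasLeft.congr (fun j hj => (hcd j (hj.trans hi)))]
  · rintro ⟨c, d, h, hv⟩
    exact (eq_leftmost_of_forall h _ (Nat.lt_succ_self _)).symm.trans hv

/-! ### Satisfaction as a relation between numbers and points of Cantor space -/

/-- The value of a term of `LAP`; it does not depend on the interpretation of `P`. -/
def termValue {n : ℕ} (t : LAP.Term (Empty ⊕ Fin n)) (xs : Fin n → ℕ) : ℕ :=
  letI := expandBy ∅
  t.realize (Sum.elim default xs)

/-- Satisfaction in `(ℕ, A)`, where `A` has the characteristic function `f`. -/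
def Sat (f : ℕ → Bool) {n : ℕ} (φ : LAP.BoundedFormula Empty n) (xs : Fin n → ℕ) : Prop :=
  letI := expandBy {i | f i = true}
  φ.Realize default xs

theorem realize_expandBy (A : Set ℕ) {n : ℕ} (t : LAP.Term (Empty ⊕ Fin n)) (xs : Fin n → ℕ) :
    @Term.realize LAP ℕ (expandBy A) _ (Sum.elim default xs) t = termValue t xs := by
  induction t with
  | var a => rfl
  | func F ts ih => exact congrArg ((expandBy A).funMap F) (funext ih)

section Sat

variable {f : ℕ → Bool} {n : ℕ} {xs : Fin n → ℕ}

theorem sat_equal (s t : LAP.Term (Empty ⊕ Fin n)) :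
    Sat f (BoundedFormula.equal s t) xs ↔ termValue s xs = termValue t xs :=
  iff_of_eq (congrArg₂ (· = ·) (realize_expandBy _ s xs) (realize_expandBy _ t xs))

theorem sat_lt (ts : Fin 2 → LAP.Term (Empty ⊕ Fin n)) :
    Sat f (BoundedFormula.rel (Sum.inl ArithRel.lt : LAP.Relations 2) ts) xs ↔
      termValue (ts 0) xs < termValue (ts 1) xs :=
  iff_of_eq (congrArg₂ (· < ·) (realize_expandBy _ (ts 0) xs) (realize_expandBy _ (ts 1) xs))

theorem sat_P (ts : Fin 1 → LAP.Term (Empty ⊕ Fin n)) :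
    Sat f (BoundedFormula.rel (Sum.inr PredRel.P : LAP.Relations 1) ts) xs ↔
      f (termValue (ts 0) xs) = true :=
  iff_of_eq (congrArg (fun k => f k = true) (realize_expandBy _ (ts 0) xs))

theorem sat_imp (φ ψ : LAP.BoundedFormula Empty n) :
    Sat f (φ.imp ψ) xs ↔ (Sat f φ xs → Sat f ψ xs) :=
  Iff.rfl

theorem sat_all (φ : LAP.BoundedFormula Empty (n + 1)) :
    Sat f φ.all xs ↔ ∀ x, Sat f φ (Fin.snoc xs x) :=
  Iff.rfl

theorem sat_ex (φ : LAP.BoundedFormula Empty (n + 1)) :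
    Sat f φ.ex xs ↔ ∃ x, Sat f φ (Fin.snoc xs x) :=
  let := expandBy {i | f i = true}
  BoundedFormula.realize_ex

theorem termValue_relabel_castSucc (t : LAP.Term (Empty ⊕ Fin n)) (x : ℕ) :
    termValue (t.relabel (Sum.map id Fin.castSucc)) (Fin.snoc xs x : Fin (n + 1) → ℕ) =
      termValue t xs := by
  let := expandBy ∅
  refine Term.realize_relabel.trans (congrArg (fun v => Term.realize v t) ?_)
  funext a
  rcases a with a | a
  · rfl
  · exact Fin.snoc_castSucc (α := fun _ => ℕ) x xs a

theorem sat_varLt (t : LAP.Term (Empty ⊕ Fin n)) (x : ℕ) :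
    Sat f (varLt arithIncl t) (Fin.snoc xs x) ↔ x < termValue t xs := by
  refine (sat_lt _).trans ?_
  refine iff_of_eq (congrArg₂ (· < ·) ?_ (termValue_relabel_castSucc t x))
  exact Fin.snoc_last (α := fun _ => ℕ) x xs

theorem sat_ballLt (t : LAP.Term (Empty ⊕ Fin n)) (φ : LAP.BoundedFormula Empty (n + 1)) :
    Sat f (ballLt arithIncl t φ) xs ↔ ∀ x < termValue t xs, Sat f φ (Fin.snoc xs x) :=
  forall_congr' fun x => imp_congr_left (sat_varLt t x)

theorem sat_bexLt (t : LAP.Term (Empty ⊕ Fin n)) (φ : LAP.BoundedFormula Empty (n + 1)) :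
    Sat f (bexLt arithIncl t φ) xs ↔ ∃ x < termValue t xs, Sat f φ (Fin.snoc xs x) := by
  let := expandBy {i | f i = true}
  refine (sat_ex _).trans (exists_congr fun x => ?_)
  exact BoundedFormula.realize_inf.trans (and_congr_left' (sat_varLt t x))

end Sat

/-! ### `Δ₀` conditions are clopen -/

theorem isClopen_setOf_const (X : Type*) [TopologicalSpace X] (p : Prop) :
    IsClopen {_x : X | p} := by
  by_cases hp : p <;> simp [hp, isClopen_univ, isClopen_empty]

theorem isClopen_imp {X : Type*} [TopologicalSpace X] {p q : X → Prop} (hp : IsClopen {x | p x})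
    (hq : IsClopen {x | q x}) : IsClopen {x | p x → q x} := by
  have e : {x | p x → q x} = {x | p x}ᶜ ∪ {x | q x} := by
    ext x
    simp [imp_iff_not_or]
  rw [e]
  exact hp.compl.union hq

theorem isClopen_forall_lt {X : Type*} [TopologicalSpace X] {p : X → ℕ → Prop} (k : ℕ)
    (hp : ∀ i, IsClopen {x | p x i}) : IsClopen {x | ∀ i < k, p x i} := by
  have e : {x | ∀ i < k, p x i} = ⋂ i ∈ {i | i < k}, {x | p x i} := by
    ext x
    simp
  rw [e]
  exact (Set.finite_lt_nat k).isClopen_biInter fun i _ => hp i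

theorem isClopen_exists_lt {X : Type*} [TopologicalSpace X] {p : X → ℕ → Prop} (k : ℕ)
    (hp : ∀ i, IsClopen {x | p x i}) : IsClopen {x | ∃ i < k, p x i} := by
  have e : {x | ∃ i < k, p x i} = {x | ∀ i < k, ¬ p x i}ᶜ := by
    ext x
    simp
  rw [e]
  exact (isClopen_forall_lt k fun i => (hp i).compl).compl

theorem isClopen_sat_of_isAtomic {n : ℕ} {φ : LAP.BoundedFormula Empty n} (h : φ.IsAtomic)
    (xs : Fin n → ℕ) : IsClopen {f | Sat f φ xs} := by
  cases h with
  | equal s t =>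
    simp only [Term.bdEqual, sat_equal]
    exact isClopen_setOf_const _ _
  | rel R ts =>
    unfold Relations.boundedFormula
    rcases R with R | R
    · cases R
      simp only [sat_lt]
      exact isClopen_setOf_const _ _
    · cases R
      simp only [sat_P]
      exact isClopen_setOf_apply_eq (termValue (ts 0) xs) true

theorem isClopen_sat_of_isQF {n : ℕ} {φ : LAP.BoundedFormula Empty n} (h : φ.IsQF)
    (xs : Fin n → ℕ) : IsClopen {f | Sat f φ xs} := by
  induction h with
  | falsum => exact isClopen_empty
  | of_isAtomic h => exact isClopen_sat_of_isAtomic h xs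
  | imp _ _ ih₁ ih₂ => exact isClopen_imp ih₁ ih₂

/-- Terms do not involve `P`, so for fixed `xs` each quantifier bound is a number independent of
`f`, and bounded quantifiers become finite intersections and unions. -/
theorem IsDeltaZero.isClopen_sat {n : ℕ} {φ : LAP.BoundedFormula Empty n}
    (h : IsDeltaZero arithIncl φ) (xs : Fin n → ℕ) : IsClopen {f | Sat f φ xs} := by
  induction h with
  | of_isQF h => exact isClopen_sat_of_isQF h xs
  | imp _ _ ih₁ ih₂ => exact isClopen_imp (ih₁ xs) (ih₂ xs)
  | ball t _ ih =>
    simp only [sat_ballLt]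
    exact isClopen_forall_lt _ fun x => ih _
  | bex t _ ih =>
    simp only [sat_bexLt]
    exact isClopen_exists_lt _ fun x => ih _

/-! ### Satisfaction at coded sets is arithmetical -/

theorem IsTermFun.termValue {β : Type} {n : ℕ} (t : LAP.Term (Empty ⊕ Fin n))
    {xs : (β → ℕ) → Fin n → ℕ} (hxs : ∀ i, IsTermFun (fun v => xs v i)) :
    IsTermFun (fun v => termValue t (xs v)) := by
  induction t with
  | var a =>
    rcases a with a | a
    · exact a.elim
    · exact hxs a
  | func F ts ih =>
    rcases F with F | F
    · cases F with
      | zero => exact .zero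
      | one => exact .one
      | add => exact (ih 0).add (ih 1)
      | mul => exact (ih 0).mul (ih 1)
    · exact nomatch F

theorem IsTermFun.snoc {β : Type} {n : ℕ} {xs : (β → ℕ) → Fin n → ℕ} {x : (β → ℕ) → ℕ}
    (hxs : ∀ i, IsTermFun (fun v => xs v i)) (hx : IsTermFun x) (i : Fin (n + 1)) :
    IsTermFun (fun v => (Fin.snoc (xs v) (x v) : Fin (n + 1) → ℕ) i) := by
  induction i using Fin.lastCases with
  | last => simpa using hx
  | cast i => simpa using hxs i

/-- Replacing `P` by the divisibility formula for `decodeSet` turns `φ` into a formula of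
arithmetic; no truth definition is needed, since `φ` is fixed. -/
theorem IsArith.sat {n : ℕ} (φ : LAP.BoundedFormula Empty n) {β : Type} {c d : (β → ℕ) → ℕ}
    {xs : (β → ℕ) → Fin n → ℕ} (hc : IsTermFun c) (hd : IsTermFun d)
    (hxs : ∀ i, IsTermFun (fun v => xs v i)) :
    IsArith (fun v => Sat (TruthArith.decodeSet (c v) (d v)) φ (xs v)) := by
  induction φ generalizing β with
  | falsum => exact .false
  | equal s t => exact (IsArith.eq (.termValue s hxs) (.termValue t hxs)).congr fun v =>
      (sat_equal s t).symm
  | rel R ts =>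
    rcases R with R | R
    · cases R
      exact (IsArith.lt (.termValue (ts 0) hxs) (.termValue (ts 1) hxs)).congr fun v =>
          (sat_lt ts).symm
    · cases R
      exact (IsArith.decodeSet hc hd (.termValue (ts 0) hxs)).congr fun v =>
          (sat_P ts).symm
  | imp φ ψ ih₁ ih₂ => exact (ih₁ hc hd hxs).imp (ih₂ hc hd hxs)
  | all φ ih => exact .all (ih hc.lift hd.lift (.snoc (fun i => (hxs i).lift) (.var none)))

/-! ### From `Π₁` to `Σ₂` -/

/-- One index `m` bounds all the universal quantifiers at once. The approximations are uniform in
`xs` so that the induction can quantify over the last entry. -/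
theorem IsPiOne.exists_clopen_approximation {n : ℕ} {φ : LAP.BoundedFormula Empty n}
    (h : IsPiOne arithIncl φ) :
    ∃ R : (Fin n → ℕ) → ℕ → Set (ℕ → Bool), (∀ xs m, IsClopen (R xs m)) ∧
      (∀ xs, Antitone (R xs)) ∧ (∀ xs f, Sat f φ xs ↔ ∀ m, f ∈ R xs m) ∧
      ∀ {β : Type} {xs : (β → ℕ) → Fin n → ℕ} {m c d : (β → ℕ) → ℕ},
        (∀ i, IsTermFun (fun v => xs v i)) → IsTermFun m → IsTermFun c → IsTermFun d →
        IsArith (fun v => decodeSet (c v) (d v) ∈ R (xs v) (m v)) := by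
  induction h with
  | @of_isDeltaZero n φ h =>
    exact ⟨fun xs _ => {f | Sat f φ xs}, fun xs _ => h.isClopen_sat xs, fun _ _ _ _ => le_rfl,
      fun _ _ => ⟨fun hf _ => hf, fun hf => hf 0⟩, fun hxs _ hc hd => .sat φ hc hd hxs⟩
  | all _ ih =>
    obtain ⟨R, hcl, hanti, hsat, hdef⟩ := ih
    refine ⟨fun xs m => {f | ∀ x < m + 1, f ∈ R (Fin.snoc xs x) m},
      fun xs m => isClopen_forall_lt _ fun x => hcl _ m, fun xs m m' hm f hf x hx => ?_,
      fun xs f => ?_, fun hxs hm hc hd => ?_⟩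
    · exact hanti _ hm (hf x (by omega))
    · simp only [sat_all, hsat]
      refine ⟨fun H m x _ => H x m, fun H x m => ?_⟩
      -- Stage `max x m` is late enough to include the instance `x`, and monotonicity brings it back
      -- to stage `m`.
      exact hanti _ (le_max_right x m) (H (max x m) x (by omega))
    · refine .all (.imp (.lt (.var _) (hm.lift.add .one)) ?_)
      exact hdef (.snoc (fun i => (hxs i).lift) (.var none)) hm.lift hc.lift hd.lift

theorem IsPiOne.exists_arithDefinable {n : ℕ} {φ : LAP.BoundedFormula Empty n}
    (h : IsPiOne arithIncl φ) {f : ℕ → Bool} {xs : Fin n → ℕ} (hf : Sat f φ xs) :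
    ∃ g : ℕ → Bool, ArithDefinable {i | g i = true} ∧ Sat g φ xs := by
  obtain ⟨R, hcl, hanti, hsat, hdef⟩ := h.exists_clopen_approximation
  refine ⟨_, arithDefinable_leftmost (hcl xs) (hanti xs)
    -- The witnesses `xs` enter as closed numerals, so the definition has no parameters.
    fun hm hc hd => hdef (fun i => .const (xs i)) hm hc hd, ?_⟩
  rw [hsat] at hf ⊢
  exact Set.mem_iInter.1 (leftmost_mem (isClosed_iInter fun m => (hcl xs m).isClosed)
    ⟨f, Set.mem_iInter.2 hf⟩)

theorem IsSigmaTwo.exists_arithDefinable {n : ℕ} {φ : LAP.BoundedFormula Empty n}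
    (h : IsSigmaTwo arithIncl φ) {f : ℕ → Bool} {xs : Fin n → ℕ} (hf : Sat f φ xs) :
    ∃ g : ℕ → Bool, ArithDefinable {i | g i = true} ∧ Sat g φ xs := by
  induction h with
  | of_isPiOne h => exact h.exists_arithDefinable hf
  | ex _ ih =>
    obtain ⟨x, hx⟩ := (sat_ex _).1 hf
    obtain ⟨g, hg, hsat⟩ := ih hx
    exact ⟨g, hg, (sat_ex _).2 ⟨x, hsat⟩⟩

/-- The only symbol not fixed by the standard model is `P`, and a unary relation on `Fin 1 → ℕ` is
determined by its values at the vectors `![i]`. -/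
theorem eq_expandBy_of_isExpansionOn (S : LAP.Structure ℕ) (h : arithIncl.IsExpansionOn ℕ) :
    S = expandBy {i | S.RelMap (Sum.inr PredRel.P : LAP.Relations 1) ![i]} := by
  refine Structure.ext ?_ ?_
  · funext n F v
    rcases F with F | F
    · exact h.map_onFunction F v
    · exact nomatch F
  · funext n r v
    rcases r with r | r
    · exact h.map_onRelation r v
    · cases r
      refine congrArg (S.RelMap (Sum.inr PredRel.P : LAP.Relations 1)) ?_
      exact funext fun i => by rw [Subsingleton.elim i 0]; rfl

theorem exists_modelsWith_of_hasStandardModel {α : LAP.Sentence}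
    (h : HasStandardModel arithIncl α) : ∃ A : Set ℕ, ModelsWith A α := by
  obtain ⟨S, hS, hα⟩ := h
  refine ⟨{i | S.RelMap (Sum.inr PredRel.P : LAP.Relations 1) ![i]}, ?_⟩
  unfold ModelsWith
  rw [← eq_expandBy_of_isExpansionOn S hS]
  exact hα

theorem modelsWith_iff_sat (f : ℕ → Bool) (α : LAP.Sentence) :
    ModelsWith {i | f i = true} α ↔ Sat f α default :=
  iff_of_eq (congrArg₂ (@BoundedFormula.Realize LAP ℕ (expandBy {i | f i = true}) Empty 0 α)
    (Subsingleton.elim _ _) (Subsingleton.elim _ _))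

end TruthArith

open Classical in
theorem mainTheorem8 (α : TruthArith.LAP.Sentence)
    (hα : TruthArith.IsSigmaTwo TruthArith.arithIncl α)
    (hstd : TruthArith.HasStandardModel TruthArith.arithIncl α) :
    ∃ A : Set ℕ, TruthArith.ArithDefinable A ∧ TruthArith.ModelsWith A α := by
  obtain ⟨A, hA⟩ := TruthArith.exists_modelsWith_of_hasStandardModel hstd
  have e : A = {i | decide (i ∈ A) = true} := by
    ext i
    simp
  rw [e, TruthArith.modelsWith_iff_sat] at hA
  obtain ⟨g, hg, hsat⟩ := hα.exists_arithDefinable hA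
  exact ⟨_, hg, (TruthArith.modelsWith_iff_sat g α).2 hsat⟩
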